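/- Let $X_1,\dots,X_n$ be jointly distributed continuous real random variables, i.e. $(X_1,\dots,X_n)$ has a joint density with respect to Lebesgue measure on $\mathbb{R}^n$. For $S\subseteq[1:n]=\{1,\dots,n\}$ write $X_S=(X_i)_{i\in S}$, let $f_{X_S}$ be its density, and let $h(X_S)=-\int f_{X_S}\log f_{X_S}$ be its differential entropy (with $h(X_\emptyset)=0$), which is assumed to be finite for every $S\subseteq[1:n]$. For disjoint $S,T$ let $h(X_S\mid X_T)=-\int f_{X_S,X_T}(x,y)\log\frac{f_{X_S,X_T}(x,y)}{f_{X_T}(y)}\,d(x,y)$ be the conditional differential entropy. Let $p\in[1:n]$, write $[p+1:n]=\{p+1,\dots,n\}$ (empty if $p=n$), let $\mathcal P$ be a partition of $[1:n]$, and let $\mathcal P'=\{S\cap[1:p]: S\in\mathcal P,\ S\cap[1:p]\neq\emptyset\}$ be the induced partition of $[1:p]$. Then $$h(X_{[1:n]})\le\sum_{S\in\mathcal P'}h(X_S\mid X_{[p+1:n]})+h(X_{[p+1:n]})\le\sum_{S\in\mathcal P}h(X_S).$$ Equality holds in the first inequality if and only if the random vectors $X_S$, $S\in\mathcal P'$,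 are (mutually) conditionally independent given $X_{[p+1:n]}$. Equality holds in the second inequality if and only if both of the following hold: (i) for every $S\in\mathcal P$, $X_{S\cap[1:p]}$ and $X_{S^{\mathrm c}\cap[p+1:n]}$ are conditionally independent given $X_{S\cap[p+1:n]}$, where $S^{\mathrm c}=[1:n]\setminus S$; and (ii) the random vectors $X_{S\cap[p+1:n]}$, $S\in\mathcal P$, are (mutually) independent. -/

import Mathlib

open MeasureTheory ProbabilityTheory

/-- Differential entropy (in nats) `h(Y) = - ∫ f_Y log f_Y` of a random element `Y` of a measure
space `E` (for instance `ℝ ^ S` with Lebesgue measure), where `f_Y` is the density of `Y`. -/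
noncomputable def diffEntropy {Ω E : Type*} [MeasurableSpace Ω] [MeasureSpace E]
    (P : Measure Ω) (Y : Ω → E) : ℝ :=
  - ∫ y : E, (pdf Y P volume y).toReal * Real.log (pdf Y P volume y).toReal

/-- The integral that defines `h(Y)` converges, i.e. `h(Y)` is a (finite) real number. -/
def FiniteDiffEntropy {Ω E : Type*} [MeasurableSpace Ω] [MeasureSpace E]
    (P : Measure Ω) (Y : Ω → E) : Prop :=
  Integrable (fun y : E => (pdf Y P volume y).toReal * Real.log (pdf Y P volume y).toReal) volume

/-- Conditional differential entropy
`h(U | V) = - ∫ f_{U,V}(u,v) log f_{U|V}(u|v) d(u,v)`, with `f_{U|V}(u|v) = f_{U,V}(u,v) / f_V(v)`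
the conditional density. -/
noncomputable def condDiffEntropy {Ω E F : Type*} [MeasurableSpace Ω] [MeasureSpace E]
    [MeasureSpace F] (P : Measure Ω) (U : Ω → E) (V : Ω → F) : ℝ :=
  - ∫ z : E × F, (pdf (fun ω => (U ω, V ω)) P volume z).toReal *
      Real.log ((pdf (fun ω => (U ω, V ω)) P volume z).toReal / (pdf V P volume z.2).toReal)

/-- The subvector `X_S = (X_i : i ∈ S)`. -/
def subvector {n : ℕ} {Ω : Type*} (X : Fin n → Ω → ℝ) (S : Finset (Fin n)) : Ω → (S → ℝ) :=
  fun ω i => X i ω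

/-- The initial indices: `[1 : p]`, which is `{0, …, p - 1}` in the zero-based indexing of
`Fin n`. -/
def initialIdx (n p : ℕ) : Finset (Fin n) := Finset.univ.filter (fun i => i.val < p)

/-- The final indices: `[p + 1 : n]`, which is `{p, …, n - 1}` in the zero-based indexing of
`Fin n`. -/
def finalIdx (n p : ℕ) : Finset (Fin n) := Finset.univ.filter (fun i => p ≤ i.val)

/-- The induced partition `{S ∩ [1 : p] : S ∈ 𝓟, S ∩ [1 : p] ≠ ∅}` of `[1 : p]`. -/
def inducedBlocks {n : ℕ} (𝓟 : Finpartition (Finset.univ : Finset (Fin n))) (p : ℕ) :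
    Finset (Finset (Fin n)) :=
  (𝓟.parts.filter (fun S => (S ∩ initialIdx n p).Nonempty)).image (fun S => S ∩ initialIdx n p)

/-- The family `(Y i)` is (mutually) conditionally independent given `Z`: for finitely many indices,
the conditional probability given `σ(Z)` of `⋂ {Y i ∈ A i}` is a.s. the product of the conditional
probabilities. -/
def CondIndepFamilyGiven {Ω ι G : Type*} {β : ι → Type*} [MeasurableSpace Ω] [MeasurableSpace G]
    [∀ i, MeasurableSpace (β i)] (P : Measure Ω) (Y : ∀ i, Ω → β i) (Z : Ω → G) : Prop :=
  ∀ (s : Finset ι) (A : ∀ i, Set (β i)), (∀ i, MeasurableSet (A i)) →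
    P⟦⋂ i ∈ s, Y i ⁻¹' A i | MeasurableSpace.comap Z inferInstance⟧ =ᵐ[P]
      ∏ i ∈ s, P⟦Y i ⁻¹' A i | MeasurableSpace.comap Z inferInstance⟧

/-- `U` and `V` are conditionally independent given `Z`. -/
def CondIndepPairGiven {Ω E F G : Type*} [MeasurableSpace Ω] [MeasurableSpace E]
    [MeasurableSpace F] [MeasurableSpace G] (P : Measure Ω) (U : Ω → E) (V : Ω → F) (Z : Ω → G) :
    Prop :=
  ∀ (A : Set E) (B : Set F), MeasurableSet A → MeasurableSet B →
    P⟦U ⁻¹' A ∩ V ⁻¹' B | MeasurableSpace.comap Z inferInstance⟧ =ᵐ[P]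
      P⟦U ⁻¹' A | MeasurableSpace.comap Z inferInstance⟧ *
        P⟦V ⁻¹' B | MeasurableSpace.comap Z inferInstance⟧

open scoped ENNReal

/-! ### Densities, entropy as an expectation, and Gibbs' inequality -/

section Density

/-! Everything follows from one inequality. For disjoint blocks `S i` and `T`, compare the joint
density with $g = f_T \prod_i f_{S_i\mid T}$, the density that has the same conditional laws of the
blocks given $X_T$ but makes them conditionally independent. Gibbs' inequality $E\log g \le E\log f$
reads $h(X_{\bigcup S_i\cup T}) \le \sum_i (h(X_{S_i\cup T}) - h(X_T)) + h(X_T)$. Equality holds iff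
the law has density $g$, and testing on boxes shows that this is conditional independence given
$X_T$ (`diffEntropy_le_sum_sub`, `condIndepFamilyGiven_iff_map_eq`).

Let $I=[1:p]$, $F=[p+1:n]$. The inequality is used three times. Induced blocks with $T=F$ give the
first claim. Blocks $S\cap F$ with $T=\emptyset$ give $h(X_F)\le\sum_S h(X_{S\cap F})$, with
equality iff (ii). The two blocks $S\cap I$ and $S^c\cap F$ with $T=S\cap F$ give $h(X_{S\cap I}\mid
X_F)\le h(X_S)-h(X_{S\cap F})$, with equality iff (i) holds for $S$. Summing the last over $S$ and
adding the second gives the second claim; as all entropies are finite, equality in the sum forces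
equality in every summand. -/

theorem pdf_lt_top_ae {Ω E : Type*} [MeasurableSpace Ω] [MeasureSpace E] (P : Measure Ω)
    [IsProbabilityMeasure P] (W : Ω → E) : ∀ᵐ x, pdf W P volume x < ∞ :=
  pdf.ae_lt_top

variable {Ω E : Type*} [MeasurableSpace Ω] [MeasureSpace E] {P : Measure Ω}
  {W : Ω → E} [HasPDF W P volume]

theorem ae_comp_of_ae_volume {p : E → Prop} (h : ∀ᵐ x : E, p x) : ∀ᵐ ω ∂P, p (W ω) :=
  ae_of_ae_map (HasPDF.aemeasurable W P volume) (HasPDF.absolutelyContinuous.ae_le h)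

theorem lintegral_comp_eq_lintegral_pdf_mul {φ : E → ℝ≥0∞} (hφ : Measurable φ) :
    ∫⁻ ω, φ (W ω) ∂P = ∫⁻ x, pdf W P volume x * φ x :=
  (pdf.lintegral_pdf_mul hφ.aemeasurable).symm

theorem pdf_comp_ne_zero_ae : ∀ᵐ ω ∂P, pdf W P volume (W ω) ≠ 0 := by
  refine ae_of_ae_map (p := fun x => pdf W P volume x ≠ 0) (HasPDF.aemeasurable W P volume) ?_
  rw [map_eq_withDensity_pdf W P volume, ae_withDensity_iff (measurable_pdf W P volume)]
  exact Filter.Eventually.of_forall fun _ h => h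

variable [IsProbabilityMeasure P]

theorem pdf_comp_toReal_pos_ae : ∀ᵐ ω ∂P, 0 < (pdf W P volume (W ω)).toReal := by
  filter_upwards [pdf_comp_ne_zero_ae (P := P) (W := W),
    ae_comp_of_ae_volume (P := P) (W := W)
      (pdf_lt_top_ae P W)] with ω h0 h1
  exact ENNReal.toReal_pos h0 h1.ne

/-- Puts the entropies of different vectors on the common space `Ω`, where their integrands can be
added and compared pointwise. -/
theorem diffEntropy_eq_integral :
    diffEntropy P W = - ∫ ω, Real.log (pdf W P volume (W ω)).toReal ∂P := by
  have hm : AEStronglyMeasurable (fun x => Real.log (pdf W P volume x).toReal) volume :=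
    (measurable_pdf W P volume).ennreal_toReal.log.aestronglyMeasurable
  rw [diffEntropy, ← pdf.integral_pdf_smul hm]
  rfl

theorem finiteDiffEntropy_iff_integrable :
    FiniteDiffEntropy P W ↔ Integrable (fun ω => Real.log (pdf W P volume (W ω)).toReal) P := by
  have hm : AEStronglyMeasurable (fun x => Real.log (pdf W P volume x).toReal) volume :=
    (measurable_pdf W P volume).ennreal_toReal.log.aestronglyMeasurable
  rw [FiniteDiffEntropy, ← pdf.integrable_pdf_smul_iff hm]
  rfl

/-- **Gibbs' inequality**, with its equality case. -/
theorem integral_log_le_integral_log_pdf {g : E → ℝ≥0∞} (hg : Measurable g)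
    (hg1 : ∫⁻ x, g x ≤ 1) (hpos : ∀ᵐ ω ∂P, g (W ω) ≠ 0)
    (hfi : Integrable (fun ω => Real.log (pdf W P volume (W ω)).toReal) P)
    (hgi : Integrable (fun ω => Real.log (g (W ω)).toReal) P) :
    ∫ ω, Real.log (g (W ω)).toReal ∂P ≤ ∫ ω, Real.log (pdf W P volume (W ω)).toReal ∂P ∧
      (∫ ω, Real.log (g (W ω)).toReal ∂P = ∫ ω, Real.log (pdf W P volume (W ω)).toReal ∂P ↔
        P.map W = volume.withDensity g) := by
  set f := pdf W P volume with hf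
  have hfm : Measurable f := measurable_pdf W P volume
  have hW : AEMeasurable W P := HasPDF.aemeasurable W P volume
  have hgtop : ∀ᵐ x, g x < ∞ := ae_lt_top hg (ne_top_of_le_ne_top ENNReal.one_ne_top hg1)
  have hgW : ∀ᵐ ω ∂P, 0 < (g (W ω)).toReal := by
    filter_upwards [hpos, ae_comp_of_ae_volume (P := P) (W := W) hgtop] with ω h0 h1
    exact ENNReal.toReal_pos h0 h1.ne
  have hfW : ∀ᵐ ω ∂P, 0 < (f (W ω)).toReal := pdf_comp_toReal_pos_ae
  -- Only an inequality: `f * (g / f)` loses the mass of `g` where `f = 0`.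
  have hlin : ∫⁻ ω, g (W ω) / f (W ω) ∂P ≤ 1 := by
    rw [lintegral_comp_eq_lintegral_pdf_mul (φ := fun x => g x / f x) (hg.div hfm)]
    exact (lintegral_mono fun x => ENNReal.mul_div_le).trans hg1
  have hrm : AEMeasurable (fun ω => g (W ω) / f (W ω)) P :=
    (hg.div hfm).comp_aemeasurable hW
  have hrint : Integrable (fun ω => (g (W ω)).toReal / (f (W ω)).toReal) P := by
    simp_rw [← ENNReal.toReal_div]
    exact integrable_toReal_of_lintegral_ne_top hrm (ne_top_of_le_ne_top ENNReal.one_ne_top hlin)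
  have hr1 : ∫ ω, (g (W ω)).toReal / (f (W ω)).toReal ∂P ≤ 1 := by
    simp_rw [← ENNReal.toReal_div]
    rw [integral_toReal hrm (ae_lt_top' hrm (ne_top_of_le_ne_top ENNReal.one_ne_top hlin))]
    exact ENNReal.toReal_le_of_le_ofReal zero_le_one (by simpa using hlin)
  -- This is $r-1-\log r\ge 0$ at $r=g/f$, zero only at $r=1$.
  set d : Ω → ℝ := fun ω => (g (W ω)).toReal / (f (W ω)).toReal - 1 -
    (Real.log (g (W ω)).toReal - Real.log (f (W ω)).toReal) with hd
  have hdint : Integrable d P := (hrint.sub (integrable_const 1)).sub (hgi.sub hfi)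
  have hd0 : 0 ≤ᵐ[P] d := by
    filter_upwards [hgW, hfW] with ω h1 h2
    have := Real.log_le_sub_one_of_pos (div_pos h1 h2)
    rw [Real.log_div h1.ne' h2.ne'] at this
    simp only [hd, Pi.zero_apply]
    linarith
  have hdval : ∫ ω, d ω ∂P = ∫ ω, (g (W ω)).toReal / (f (W ω)).toReal ∂P - 1 -
      (∫ ω, Real.log (g (W ω)).toReal ∂P - ∫ ω, Real.log (f (W ω)).toReal ∂P) := by
    rw [integral_sub (f := fun ω => (g (W ω)).toReal / (f (W ω)).toReal - 1)
      (g := fun ω => Real.log (g (W ω)).toReal - Real.log (f (W ω)).toReal)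
      (hrint.sub (integrable_const 1)) (hgi.sub hfi),
      integral_sub hrint (integrable_const 1), integral_sub hgi hfi]
    simp
  have hdnn : 0 ≤ ∫ ω, d ω ∂P := integral_nonneg_of_ae hd0
  refine ⟨by linarith, fun heq => ?_, fun h => ?_⟩
  · have hz : ∫ ω, d ω ∂P = 0 := by linarith
    rw [integral_eq_zero_iff_of_nonneg_ae hd0 hdint] at hz
    have hfg : ∀ᵐ ω ∂P, f (W ω) = g (W ω) := by
      filter_upwards [hz, hgW, hfW] with ω h0 h1 h2
      simp only [hd, Pi.zero_apply] at h0
      have h3 : (g (W ω)).toReal / (f (W ω)).toReal = 1 := by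
        by_contra hne
        have := Real.log_lt_sub_one_of_pos (div_pos h1 h2) hne
        rw [Real.log_div h1.ne' h2.ne'] at this
        linarith
      rw [div_eq_one_iff_eq h2.ne', ENNReal.toReal_eq_toReal_iff'
        (ENNReal.toReal_pos_iff.1 h1).2.ne (ENNReal.toReal_pos_iff.1 h2).2.ne] at h3
      exact h3.symm
    -- Equality is known only where `f ≠ 0`, so a priori just `f ≤ g`; then `∫ g ≤ 1 = ∫ f` forces
    -- equality a.e.
    have hle : f ≤ᵐ[volume] g := by
      have := (ae_map_iff hW (measurableSet_eq_fun hfm hg)).2 hfg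
      rw [map_eq_withDensity_pdf W P volume, ae_withDensity_iff hfm] at this
      filter_upwards [this] with x hx
      by_cases h0 : f x = 0
      · simp [h0]
      · exact (hx h0).le
    have hf1 : ∫⁻ x, f x = 1 := by rw [hf, pdf.lintegral_eq_measure_univ, measure_univ]
    have := ae_eq_of_ae_le_of_lintegral_le hle (by simp [hf1]) hg.aemeasurable (hg1.trans hf1.ge)
    rw [map_eq_withDensity_pdf W P volume]
    exact withDensity_congr_ae this
  · have := (pdf.eq_of_map_eq_withDensity g hg.aemeasurable).1 h
    refine integral_congr_ae ?_
    filter_upwards [ae_comp_of_ae_volume (P := P) (W := W) this] with ω hω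
    rw [hf, hω]

end Density

/-! ### Product integrals and measures determined by boxes -/

namespace MeasureTheory

/-- Tonelli's theorem for a product of functions of the single coordinates. -/
theorem lintegral_fintype_prod_eq_prod {ι : Type*} [Fintype ι] {E : ι → Type*}
    [∀ i, MeasurableSpace (E i)] (μ : ∀ i, Measure (E i)) [∀ i, SigmaFinite (μ i)]
    {f : ∀ i, E i → ℝ≥0∞} (hf : ∀ i, Measurable (f i)) (hfin : ∀ i, ∫⁻ x, f i x ∂μ i ≠ ∞) :
    ∫⁻ x, ∏ i, f i (x i) ∂Measure.pi μ = ∏ i, ∫⁻ x, f i x ∂μ i := by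
  have hlt : ∀ᵐ x ∂Measure.pi μ, ∀ i, f i (x i) ≠ ∞ := by
    rw [ae_all_iff]
    intro i
    filter_upwards [Measure.tendsto_eval_ae_ae.eventually (ae_lt_top (hf i) (hfin i))] with x hx
    exact hx.ne
  have hint : ∀ i, Integrable (fun x => (f i x).toReal) (μ i) := fun i =>
    integrable_toReal_of_lintegral_ne_top (hf i).aemeasurable (hfin i)
  calc ∫⁻ x, ∏ i, f i (x i) ∂Measure.pi μ
      = ∫⁻ x, ENNReal.ofReal (∏ i, (f i (x i)).toReal) ∂Measure.pi μ := by
        refine lintegral_congr_ae ?_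
        filter_upwards [hlt] with x hx
        rw [ENNReal.ofReal_prod_of_nonneg fun _ _ => ENNReal.toReal_nonneg]
        exact Finset.prod_congr rfl fun i _ => (ENNReal.ofReal_toReal (hx i)).symm
    _ = ENNReal.ofReal (∫ x, ∏ i, (f i (x i)).toReal ∂Measure.pi μ) := by
        rw [ofReal_integral_eq_lintegral_ofReal
          (Integrable.fintype_prod_dep (f := fun i x => (f i x).toReal) hint)]
        exact Filter.Eventually.of_forall fun x =>
          Finset.prod_nonneg fun _ _ => ENNReal.toReal_nonneg
    _ = ∏ i, ∫⁻ x, f i x ∂μ i := by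
        rw [integral_fintype_prod_eq_prod (fun i x => (f i x).toReal),
          ENNReal.ofReal_prod_of_nonneg
            fun _ _ => integral_nonneg fun _ => ENNReal.toReal_nonneg]
        refine Finset.prod_congr rfl fun i _ => ?_
        rw [integral_toReal (hf i).aemeasurable (ae_lt_top (hf i) (hfin i)),
          ENNReal.ofReal_toReal (hfin i)]

/-- Finite measures on `(∀ i, E i) × G` that agree on measurable boxes are equal. -/
theorem Measure.ext_pi_prod {ι : Type*} [Fintype ι] {E : ι → Type*} {G : Type*}
    [∀ i, MeasurableSpace (E i)] [MeasurableSpace G] {μ ν : Measure ((∀ i, E i) × G)}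
    [IsFiniteMeasure μ]
    (h : ∀ (A : ∀ i, Set (E i)) (B : Set G), (∀ i, MeasurableSet (A i)) → MeasurableSet B →
      μ (Set.univ.pi A ×ˢ B) = ν (Set.univ.pi A ×ˢ B)) : μ = ν := by
  have hfst : ∀ (ρ : Measure ((∀ i, E i) × G)) (s : Set (∀ i, E i)) (B : Set G),
      MeasurableSet s → MeasurableSet B →
      (ρ.restrict (Set.univ ×ˢ B)).map Prod.fst s = ρ (s ×ˢ B) := by
    intro ρ s B hs hB
    rw [Measure.map_apply measurable_fst hs, Measure.restrict_apply (measurable_fst hs)]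
    congr 1
    ext ⟨x, y⟩
    simp
  -- With the second side `t` fixed, both measures become finite measures on `∀ i, E i`, and the
  -- π-system of boxes decides.
  refine Measure.ext_prod fun {s t} hs ht => ?_
  rw [← hfst μ s t hs ht, ← hfst ν s t hs ht]
  congr 1
  refine ext_of_generate_finite _ generateFrom_pi.symm isPiSystem_pi ?_ ?_
  · rintro _ ⟨A, hA, rfl⟩
    have hA' : ∀ i, MeasurableSet (A i) := fun i => hA i (Set.mem_univ i)
    rw [hfst μ _ t (.univ_pi hA') ht, hfst ν _ t (.univ_pi hA') ht]
    exact h A t hA' ht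
  · have := h (fun _ => Set.univ) t (fun _ => .univ) ht
    rw [Set.pi_univ] at this
    rw [hfst μ _ t .univ ht, hfst ν _ t .univ ht, this]

end MeasureTheory

/-! ### Versions of conditional probabilities given a random element with a density -/

section CondProb

variable {Ω F : Type*} [MeasurableSpace Ω] [MeasureSpace F] {P : Measure Ω}
  [IsProbabilityMeasure P] {V : Ω → F} [HasPDF V P volume]

/-- Characterisation of a version `r ∘ V` of the conditional probability given `V`. -/
theorem condExp_indicator_ae_eq_iff (hV : Measurable V) {r : F → ℝ≥0∞} (hr : Measurable r)
    (hr1 : ∀ᵐ z, pdf V P volume z ≠ 0 → r z ≤ 1) {S : Set Ω} (hS : MeasurableSet S) :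
    P⟦S | MeasurableSpace.comap V inferInstance⟧ =ᵐ[P] (fun ω => (r (V ω)).toReal) ↔
      ∀ B, MeasurableSet B → P (S ∩ V ⁻¹' B) = ∫⁻ z in B, pdf V P volume z * r z := by
  -- The bound is needed only where the density of `V` is nonzero, because `V` almost surely takes
  -- its values there.
  have hr1' : ∀ᵐ ω ∂P, r (V ω) ≤ 1 := by
    filter_upwards [ae_comp_of_ae_volume (P := P) (W := V) hr1,
      pdf_comp_ne_zero_ae (P := P) (W := V)] with ω h1 h2 using h1 h2
  have hrV : AEMeasurable (fun ω => r (V ω)) P := (hr.comp hV).aemeasurable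
  have hlt : ∀ᵐ ω ∂P, r (V ω) < ∞ := hr1'.mono fun ω h => h.trans_lt ENNReal.one_lt_top
  have hne : ∫⁻ ω, r (V ω) ∂P ≠ ∞ := by
    refine ne_top_of_le_ne_top ENNReal.one_ne_top ((lintegral_mono_ae hr1').trans ?_)
    simp
  have hint : Integrable (fun ω => (r (V ω)).toReal) P :=
    integrable_toReal_of_lintegral_ne_top hrV hne
  have hset : ∀ B, MeasurableSet B →
      ∫ ω in V ⁻¹' B, (r (V ω)).toReal ∂P = (∫⁻ z in B, pdf V P volume z * r z).toReal := by
    intro B hB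
    rw [integral_toReal hrV.restrict (ae_restrict_of_ae hlt),
      ← lintegral_indicator (hV hB), ← lintegral_indicator hB]
    have := lintegral_comp_eq_lintegral_pdf_mul (P := P) (W := V) (hr.indicator hB)
    congr 1
    calc _ = ∫⁻ ω, B.indicator r (V ω) ∂P := rfl
      _ = _ := by
        rw [this]
        refine lintegral_congr fun z => ?_
        by_cases hz : z ∈ B <;> simp [hz]
  have hsetne : ∀ B, MeasurableSet B → ∫⁻ z in B, pdf V P volume z * r z ≠ ∞ := by
    intro B hB
    refine ne_top_of_le_ne_top hne ?_
    rw [lintegral_comp_eq_lintegral_pdf_mul hr]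
    exact setLIntegral_le_lintegral _ _
  have hSint : Integrable (S.indicator fun _ => (1 : ℝ)) P := (integrable_const 1).indicator hS
  have hSset : ∀ B, MeasurableSet B →
      ∫ ω in V ⁻¹' B, S.indicator (fun _ => (1 : ℝ)) ω ∂P = (P (S ∩ V ⁻¹' B)).toReal := by
    intro B hB
    rw [setIntegral_indicator hS, Set.inter_comm]
    simp [Measure.real]
  constructor
  · intro h B hB
    rw [← ENNReal.toReal_eq_toReal_iff' (measure_ne_top _ _) (hsetne B hB), ← hset B hB,
      ← hSset B hB, ← setIntegral_condExp hV.comap_le hSint ⟨B, hB, rfl⟩]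
    exact integral_congr_ae (ae_restrict_of_ae h)
  · intro h
    refine (ae_eq_condExp_of_forall_setIntegral_eq hV.comap_le hSint
      (fun _ _ _ => hint.integrableOn) ?_ ?_).symm
    · rintro _ ⟨B, hB, rfl⟩ -
      rw [hset B hB, hSset B hB, h B hB]
    · exact ((hr.ennreal_toReal).comp (comap_measurable V)).aestronglyMeasurable

end CondProb

/-! ### Conditional densities -/

section CondDensity

variable {Ω E F : Type*} [MeasurableSpace Ω] [MeasureSpace E] [MeasureSpace F]

/-- The conditional density `f_{U,V}(u,v) / f_V(v)` of `U` given `V`. -/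
noncomputable def condPDF (P : Measure Ω) (U : Ω → E) (V : Ω → F) (x : E) (z : F) : ℝ≥0∞ :=
  pdf (fun ω => (U ω, V ω)) P volume (x, z) / pdf V P volume z

theorem measurable_condPDF (P : Measure Ω) (U : Ω → E) (V : Ω → F) :
    Measurable fun w : E × F => condPDF P U V w.1 w.2 :=
  (measurable_pdf (fun ω => (U ω, V ω)) P volume).div
    ((measurable_pdf V P volume).comp measurable_snd)

variable [SigmaFinite (volume : Measure E)] {P : Measure Ω} {U : Ω → E} {V : Ω → F}

theorem measurable_setLIntegral_condPDF (A : Set E) :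
    Measurable fun z => ∫⁻ x in A, condPDF P U V x z :=
  (measurable_condPDF P U V).lintegral_prod_left'

variable [SigmaFinite (volume : Measure F)] [HasPDF (fun ω => (U ω, V ω)) P volume]

theorem setLIntegral_pdf_prod (hU : Measurable U) (hV : Measurable V) {A : Set E} {B : Set F}
    (hA : MeasurableSet A) (hB : MeasurableSet B) :
    ∫⁻ z in B, ∫⁻ x in A, pdf (fun ω => (U ω, V ω)) P volume (x, z) =
      P (U ⁻¹' A ∩ V ⁻¹' B) := by
  have h := map_eq_setLIntegral_pdf (fun ω => (U ω, V ω)) P volume (hA.prod hB)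
  rw [Measure.map_apply (hU.prodMk hV) (hA.prod hB), Measure.volume_eq_prod,
    ← Measure.prod_restrict, lintegral_prod_symm' _ (measurable_pdf _ P _)] at h
  exact h.symm

variable [HasPDF V P volume]

/-- By Tonelli, both sides are densities of the law of `V`. -/
theorem lintegral_pdf_prod_left (hU : Measurable U) (hV : Measurable V) :
    ∀ᵐ z, ∫⁻ x, pdf (fun ω => (U ω, V ω)) P volume (x, z) = pdf V P volume z := by
  have hm : Measurable fun z => ∫⁻ x, pdf (fun ω => (U ω, V ω)) P volume (x, z) :=
    (measurable_pdf (fun ω => (U ω, V ω)) P volume).lintegral_prod_left'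
  refine ((pdf.eq_of_map_eq_withDensity' _ hm.aemeasurable).1 ?_).symm
  ext B hB
  rw [withDensity_apply _ hB, Measure.map_apply hV hB]
  have := setLIntegral_pdf_prod (P := P) hU hV MeasurableSet.univ hB
  simpa using this.symm

variable [IsProbabilityMeasure P]

/-- The division is undone even where $f_V(z)=0$: there the section $f_{U,V}(\cdot,z)$ has integral
zero. -/
theorem pdf_mul_setLIntegral_condPDF (hU : Measurable U) (hV : Measurable V) (A : Set E) :
    ∀ᵐ z, pdf V P volume z * ∫⁻ x in A, condPDF P U V x z =
      ∫⁻ x in A, pdf (fun ω => (U ω, V ω)) P volume (x, z) := by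
  filter_upwards [lintegral_pdf_prod_left (P := P) hU hV, pdf_lt_top_ae P V]
    with z hz hlt
  have hm : Measurable fun x => pdf (fun ω => (U ω, V ω)) P volume (x, z) :=
    (measurable_pdf (fun ω => (U ω, V ω)) P volume).comp measurable_prodMk_right
  simp only [condPDF, div_eq_mul_inv]
  rw [lintegral_mul_const _ hm]
  by_cases h0 : pdf V P volume z = 0
  · have h1 : ∫⁻ x in A, pdf (fun ω => (U ω, V ω)) P volume (x, z) = 0 :=
      le_antisymm ((setLIntegral_le_lintegral _ _).trans (hz.trans h0).le) zero_le
    rw [h0, h1, zero_mul]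
  · rw [mul_comm, mul_assoc, ENNReal.inv_mul_cancel h0 hlt.ne, mul_one]

theorem lintegral_condPDF (hU : Measurable U) (hV : Measurable V) :
    ∀ᵐ z, pdf V P volume z ≠ 0 → ∫⁻ x, condPDF P U V x z = 1 := by
  filter_upwards [lintegral_pdf_prod_left (P := P) hU hV, pdf_lt_top_ae P V,
    pdf_mul_setLIntegral_condPDF (P := P) hU hV Set.univ] with z hz hlt hmul h0
  rw [Measure.restrict_univ, hz] at hmul
  exact (ENNReal.mul_right_inj h0 hlt.ne).1 (by rw [hmul, mul_one])

theorem lintegral_condPDF_ne_top (hU : Measurable U) (hV : Measurable V) :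
    ∀ᵐ z, ∫⁻ x, condPDF P U V x z ≠ ∞ := by
  filter_upwards [lintegral_pdf_prod_left (P := P) hU hV, lintegral_condPDF (P := P) hU hV]
    with z hz h1
  -- Where $f_V(z)=0$ the integral is `0 * ∞ = 0` in `ℝ≥0∞`.
  by_cases h0 : pdf V P volume z = 0
  · have hm : Measurable fun x => pdf (fun ω => (U ω, V ω)) P volume (x, z) :=
      (measurable_pdf (fun ω => (U ω, V ω)) P volume).comp measurable_prodMk_right
    simp only [condPDF, div_eq_mul_inv]
    rw [lintegral_mul_const _ hm, hz, h0, zero_mul]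
    exact ENNReal.zero_ne_top
  · rw [h1 h0]
    exact ENNReal.one_ne_top

theorem setLIntegral_condPDF_le_one (hU : Measurable U) (hV : Measurable V) (A : Set E) :
    ∀ᵐ z, pdf V P volume z ≠ 0 → ∫⁻ x in A, condPDF P U V x z ≤ 1 := by
  filter_upwards [lintegral_condPDF (P := P) hU hV] with z h1 h0
  exact (setLIntegral_le_lintegral _ _).trans (h1 h0).le

theorem condExp_preimage_ae_eq (hU : Measurable U) (hV : Measurable V) {A : Set E}
    (hA : MeasurableSet A) :
    P⟦U ⁻¹' A | MeasurableSpace.comap V inferInstance⟧ =ᵐ[P]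
      fun ω => (∫⁻ x in A, condPDF P U V x (V ω)).toReal := by
  refine (condExp_indicator_ae_eq_iff hV (measurable_setLIntegral_condPDF A)
    (setLIntegral_condPDF_le_one hU hV A) (hU hA)).2 fun B hB => ?_
  rw [← setLIntegral_pdf_prod hU hV hA hB]
  exact lintegral_congr_ae (ae_restrict_of_ae
    ((pdf_mul_setLIntegral_condPDF hU hV A).mono fun z hz => hz.symm))

end CondDensity

/-! ### Conditional independence: trivial conditioning, full intersections, pairs -/

section CondIndep

variable {Ω ι G : Type*} {E : ι → Type*} [MeasurableSpace Ω] {P : Measure Ω}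
  [IsProbabilityMeasure P] {Y : ∀ i, Ω → E i} {Z : Ω → G}

/-- A one-point codomain generates the trivial σ-algebra, so conditional probabilities are
constants. Used for the empty subvector. -/
theorem condIndepFamilyGiven_iff_iIndepFun [∀ i, MeasurableSpace (E i)] [MeasurableSpace G]
    [Subsingleton G] (hY : ∀ i, Measurable (Y i)) :
    CondIndepFamilyGiven P Y Z ↔ iIndepFun Y P := by
  classical
  have hbot : MeasurableSpace.comap Z inferInstance = (⊥ : MeasurableSpace Ω) := by
    rw [eq_bot_iff]
    rintro _ ⟨B, -, rfl⟩
    rw [MeasurableSpace.measurableSet_bot_iff]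
    rcases Set.eq_empty_or_nonempty B with rfl | hB
    · exact Or.inl rfl
    · exact Or.inr (by rw [Subsingleton.eq_univ_of_nonempty hB, Set.preimage_univ])
  have hreal : ∀ S : Set Ω, MeasurableSet S → P⟦S | (⊥ : MeasurableSpace Ω)⟧ =
      fun _ => P.real S := by
    intro S hS
    rw [condExp_bot]
    ext
    rw [integral_indicator hS]
    simp
  have key : ∀ (s : Finset ι) (A : ∀ i, Set (E i)), (∀ i, MeasurableSet (A i)) →
      (P⟦⋂ i ∈ s, Y i ⁻¹' A i | MeasurableSpace.comap Z inferInstance⟧ =ᵐ[P]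
        ∏ i ∈ s, P⟦Y i ⁻¹' A i | MeasurableSpace.comap Z inferInstance⟧ ↔
      P (⋂ i ∈ s, Y i ⁻¹' A i) = ∏ i ∈ s, P (Y i ⁻¹' A i)) := by
    intro s A hA
    rw [hbot, hreal _ (Finset.measurableSet_biInter _ fun i _ => hY i (hA i)),
      Finset.prod_congr rfl fun i _ => hreal _ (hY i (hA i)),
      ← ENNReal.toReal_eq_toReal_iff' (measure_ne_top _ _)
        (ENNReal.prod_ne_top fun i _ => measure_ne_top _ _), ENNReal.toReal_prod]
    constructor
    · intro h
      obtain ⟨ω, hω⟩ := h.exists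
      simpa [Finset.prod_apply, Measure.real] using hω
    · intro h
      refine Filter.Eventually.of_forall fun ω => ?_
      simpa [Finset.prod_apply, Measure.real] using h
  rw [iIndepFun_iff_measure_inter_preimage_eq_mul]
  refine forall_congr' fun s => ⟨fun h A hA => ?_, fun h A hA => (key s A hA).2 (h fun i _ => hA i)⟩
  -- `iIndepFun` assumes measurability only for indices in `s`; the other sets are replaced by
  -- `univ`.
  have hB : ∀ i, MeasurableSet (if i ∈ s then A i else Set.univ) := by
    intro i
    split_ifs with hi
    exacts [hA i hi, .univ]
  have h1 := (key s _ hB).1 (h _ hB)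
  rw [Finset.prod_congr rfl fun i hi => by rw [if_pos hi]] at h1
  rw [← h1]
  congr 1
  exact Set.iInter₂_congr fun i hi => by rw [if_pos hi]

variable [Fintype ι]

/-- For a finite family it is enough to test the full intersections. -/
theorem condIndepFamilyGiven_iff [∀ i, MeasurableSpace (E i)] [MeasurableSpace G]
    (hZ : Measurable Z) :
    CondIndepFamilyGiven P Y Z ↔ ∀ A : ∀ i, Set (E i), (∀ i, MeasurableSet (A i)) →
      P⟦⋂ i, Y i ⁻¹' A i | MeasurableSpace.comap Z inferInstance⟧ =ᵐ[P]
        ∏ i, P⟦Y i ⁻¹' A i | MeasurableSpace.comap Z inferInstance⟧ := by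
  classical
  constructor
  · intro h A hA
    simpa using h Finset.univ A hA
  · intro h s A hA
    have hB : ∀ i, MeasurableSet (if i ∈ s then A i else Set.univ) := by
      intro i
      split_ifs
      exacts [hA i, .univ]
    have h1 := h _ hB
    have hset : ⋂ i, Y i ⁻¹' (if i ∈ s then A i else Set.univ) = ⋂ i ∈ s, Y i ⁻¹' A i := by
      ext ω
      simp only [Set.mem_iInter, Set.mem_preimage]
      refine forall_congr' fun i => ?_
      by_cases hi : i ∈ s <;> simp [hi]
    have hprod : ∏ i, P⟦Y i ⁻¹' (if i ∈ s then A i else Set.univ) |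
        MeasurableSpace.comap Z inferInstance⟧ =
        ∏ i ∈ s, P⟦Y i ⁻¹' A i | MeasurableSpace.comap Z inferInstance⟧ := by
      rw [← Finset.prod_subset (Finset.subset_univ s)]
      · exact Finset.prod_congr rfl fun i hi => by simp [hi]
      · intro i _ hi
        simp only [hi, if_false, Set.preimage_univ, Set.indicator_univ]
        rw [condExp_const hZ.comap_le]
        rfl
    rwa [hset, hprod] at h1

theorem condIndepPairGiven_iff_family {β : Bool → Type*} [∀ b, MeasurableSpace (β b)]
    [MeasurableSpace G] {Y : ∀ b, Ω → β b} (hZ : Measurable Z) :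
    CondIndepPairGiven P (Y true) (Y false) Z ↔ CondIndepFamilyGiven P Y Z := by
  rw [condIndepFamilyGiven_iff hZ]
  have hinter : ∀ A : ∀ b, Set (β b),
      ⋂ b, Y b ⁻¹' A b = Y true ⁻¹' A true ∩ Y false ⁻¹' A false := by
    intro A
    ext ω
    simp [and_comm]
  constructor
  · intro h A hA
    rw [hinter, Fintype.prod_bool]
    exact h _ _ (hA true) (hA false)
  · intro h A B hA hB
    have := h (fun b => match b with | true => A | false => B) (fun b => by
      cases b
      exacts [hB, hA])
    rwa [hinter, Fintype.prod_bool] at this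

end CondIndep

/-! ### The conditionally independent comparison density -/

section FamilyDensity

variable {Ω ι G : Type*} {E : ι → Type*} [MeasurableSpace Ω] [Fintype ι]
  [∀ i, MeasureSpace (E i)] [MeasureSpace G]

/-- The density `f_Z(z) ∏ᵢ f_{Yᵢ|Z}(yᵢ|z)`, for which the `Yᵢ` are conditionally independent
given `Z`. -/
noncomputable def condProdPDF (P : Measure Ω) (Y : ∀ i, Ω → E i) (Z : Ω → G)
    (w : (∀ i, E i) × G) : ℝ≥0∞ :=
  pdf Z P volume w.2 * ∏ i, condPDF P (Y i) Z (w.1 i) w.2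

theorem measurable_condProdPDF (P : Measure Ω) (Y : ∀ i, Ω → E i) (Z : Ω → G) :
    Measurable (condProdPDF P Y Z) := by
  refine ((measurable_pdf Z P volume).comp measurable_snd).mul
    (Finset.measurable_prod _ fun i _ => ?_)
  exact (measurable_condPDF P (Y i) Z).comp
    (((measurable_pi_apply i).comp measurable_fst).prodMk measurable_snd)

variable [∀ i, SigmaFinite (volume : Measure (E i))] [SigmaFinite (volume : Measure G)]
  {P : Measure Ω} [IsProbabilityMeasure P] {Y : ∀ i, Ω → E i} {Z : Ω → G}
  [∀ i, HasPDF (fun ω => (Y i ω, Z ω)) P volume] [HasPDF Z P volume]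

theorem withDensity_condProdPDF_box (hY : ∀ i, Measurable (Y i)) (hZ : Measurable Z)
    {A : ∀ i, Set (E i)} {B : Set G} (hA : ∀ i, MeasurableSet (A i)) (hB : MeasurableSet B) :
    volume.withDensity (condProdPDF P Y Z) (Set.univ.pi A ×ˢ B) =
      ∫⁻ z in B, pdf Z P volume z * ∏ i, ∫⁻ y in A i, condPDF P (Y i) Z y z := by
  rw [withDensity_apply _ ((MeasurableSet.univ_pi hA).prod hB), Measure.volume_eq_prod,
    ← Measure.prod_restrict, lintegral_prod_symm' _ (measurable_condProdPDF P Y Z)]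
  refine lintegral_congr_ae (ae_restrict_of_ae ?_)
  filter_upwards [ae_all_iff.2 fun i => lintegral_condPDF_ne_top (P := P) (hY i) hZ] with z hz
  have hm : ∀ i, Measurable fun y => condPDF P (Y i) Z y z := fun i =>
    (measurable_condPDF P (Y i) Z).comp measurable_prodMk_right
  simp only [condProdPDF]
  have hmprod : Measurable fun x : ∀ i, E i => ∏ i, condPDF P (Y i) Z (x i) z :=
    Finset.measurable_prod _ fun i _ => (hm i).comp (measurable_pi_apply i)
  rw [lintegral_const_mul _ hmprod, volume_pi, Measure.restrict_pi_pi,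
    lintegral_fintype_prod_eq_prod _ hm fun i =>
      ne_top_of_le_ne_top (hz i) (setLIntegral_le_lintegral _ _)]

theorem lintegral_condProdPDF (hY : ∀ i, Measurable (Y i)) (hZ : Measurable Z) :
    ∫⁻ w, condProdPDF P Y Z w = 1 := by
  have h := withDensity_condProdPDF_box (P := P) hY hZ (A := fun _ => Set.univ)
    (B := Set.univ) (fun _ => .univ) .univ
  rw [Set.pi_univ, Set.univ_prod_univ, withDensity_apply _ .univ, Measure.restrict_univ,
    Measure.restrict_univ] at h
  rw [h, ← measure_univ (μ := P), ← pdf.lintegral_eq_measure_univ (X := Z) (μ := volume)]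
  refine lintegral_congr_ae ?_
  filter_upwards [ae_all_iff.2 fun i => lintegral_condPDF (P := P) (hY i) hZ] with z hz
  by_cases h0 : pdf Z P volume z = 0
  · simp [h0]
  · simp [hz _ h0]

/-- For fixed `A`, the product formula for conditional probabilities says exactly that the two
measures agree on all boxes with sides `A` and arbitrary `B`; such boxes determine a finite measure.
-/
theorem condIndepFamilyGiven_iff_map_eq (hY : ∀ i, Measurable (Y i)) (hZ : Measurable Z) :
    CondIndepFamilyGiven P Y Z ↔
      P.map (fun ω => ((fun i => Y i ω), Z ω)) = volume.withDensity (condProdPDF P Y Z) := by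
  have hW : Measurable fun ω => ((fun i => Y i ω), Z ω) := (measurable_pi_lambda _ hY).prodMk hZ
  have hbox : ∀ (A : ∀ i, Set (E i)) (B : Set G), (∀ i, MeasurableSet (A i)) → MeasurableSet B →
      P.map (fun ω => ((fun i => Y i ω), Z ω)) (Set.univ.pi A ×ˢ B) =
        P ((⋂ i, Y i ⁻¹' A i) ∩ Z ⁻¹' B) := by
    intro A B hA hB
    rw [Measure.map_apply hW ((MeasurableSet.univ_pi hA).prod hB)]
    congr 1
    ext ω
    simp
  have hA_iff : ∀ A : ∀ i, Set (E i), (∀ i, MeasurableSet (A i)) →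
      (P⟦⋂ i, Y i ⁻¹' A i | MeasurableSpace.comap Z inferInstance⟧ =ᵐ[P]
        ∏ i, P⟦Y i ⁻¹' A i | MeasurableSpace.comap Z inferInstance⟧ ↔
      ∀ B, MeasurableSet B → P.map (fun ω => ((fun i => Y i ω), Z ω)) (Set.univ.pi A ×ˢ B) =
        volume.withDensity (condProdPDF P Y Z) (Set.univ.pi A ×ˢ B)) := by
    intro A hA
    have hprod : (∏ i, P⟦Y i ⁻¹' A i | MeasurableSpace.comap Z inferInstance⟧) =ᵐ[P]
        fun ω => (∏ i, ∫⁻ y in A i, condPDF P (Y i) Z y (Z ω)).toReal := by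
      filter_upwards [ae_all_iff.2 fun i => condExp_preimage_ae_eq (P := P) (hY i) hZ (hA i)]
        with ω hω
      rw [Finset.prod_apply, ENNReal.toReal_prod]
      exact Finset.prod_congr rfl fun i _ => hω i
    have hle : ∀ᵐ z, pdf Z P volume z ≠ 0 →
        ∏ i, ∫⁻ y in A i, condPDF P (Y i) Z y z ≤ 1 := by
      filter_upwards [ae_all_iff.2 fun i =>
        setLIntegral_condPDF_le_one (P := P) (hY i) hZ (A i)] with z hz h0
      exact Finset.prod_le_one' fun i _ => hz i h0
    have hmeas : Measurable fun z => ∏ i, ∫⁻ y in A i, condPDF P (Y i) Z y z :=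
      Finset.measurable_prod _ fun i _ => measurable_setLIntegral_condPDF (A i)
    have hS : MeasurableSet (⋂ i, Y i ⁻¹' A i) := .iInter fun i => hY i (hA i)
    rw [show (P⟦⋂ i, Y i ⁻¹' A i | MeasurableSpace.comap Z inferInstance⟧ =ᵐ[P]
        ∏ i, P⟦Y i ⁻¹' A i | MeasurableSpace.comap Z inferInstance⟧) ↔ _ from
        ⟨fun h => h.trans hprod, fun h => h.trans hprod.symm⟩,
      condExp_indicator_ae_eq_iff hZ hmeas hle hS]
    refine forall_congr' fun B => forall_congr' fun hB => ?_
    rw [hbox A B hA hB, withDensity_condProdPDF_box hY hZ hA hB]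
  rw [condIndepFamilyGiven_iff hZ]
  constructor
  · intro h
    have := Measure.isProbabilityMeasure_map (μ := P) hW.aemeasurable
    exact Measure.ext_pi_prod fun A B hA hB => (hA_iff A hA).1 (h A hA) B hB
  · intro h A hA
    exact (hA_iff A hA).2 fun B _ => by rw [h]

end FamilyDensity

/-! ### Chain rule and conditional subadditivity -/

section Entropy

variable {Ω G : Type*} [MeasurableSpace Ω] [MeasureSpace G] {P : Measure Ω}
  [IsProbabilityMeasure P] {Z : Ω → G} [HasPDF Z P volume]

/-- Almost surely both densities are positive and finite, so the logarithm of the quotient splits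
with no convention for `Real.log 0` involved. -/
theorem log_condPDF_ae {F : Type*} [MeasureSpace F] {U : Ω → F}
    [HasPDF (fun ω => (U ω, Z ω)) P volume] :
    ∀ᵐ ω ∂P, 0 < (condPDF P U Z (U ω) (Z ω)).toReal ∧
      Real.log (condPDF P U Z (U ω) (Z ω)).toReal =
      Real.log (pdf (fun ω => (U ω, Z ω)) P volume (U ω, Z ω)).toReal -
        Real.log (pdf Z P volume (Z ω)).toReal := by
  filter_upwards [pdf_comp_toReal_pos_ae (P := P) (W := fun ω => (U ω, Z ω)),
    pdf_comp_toReal_pos_ae (P := P) (W := Z)] with ω h1 h2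
  rw [condPDF, ENNReal.toReal_div]
  exact ⟨div_pos h1 h2, Real.log_div h1.ne' h2.ne'⟩

/-- The chain rule `h(U | Z) = h(U, Z) - h(Z)`. -/
theorem condDiffEntropy_eq_sub {F : Type*} [MeasureSpace F] {U : Ω → F}
    [HasPDF (fun ω => (U ω, Z ω)) P volume]
    (hUZ : FiniteDiffEntropy P (fun ω => (U ω, Z ω))) (hZ : FiniteDiffEntropy P Z) :
    condDiffEntropy P U Z = diffEntropy P (fun ω => (U ω, Z ω)) - diffEntropy P Z := by
  have hm : AEStronglyMeasurable (fun w : F × G =>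
      Real.log ((pdf (fun ω => (U ω, Z ω)) P volume w).toReal /
        (pdf Z P volume w.2).toReal)) volume :=
    ((measurable_pdf (fun ω => (U ω, Z ω)) P volume).ennreal_toReal.div
      ((measurable_pdf Z P volume).comp measurable_snd).ennreal_toReal).log.aestronglyMeasurable
  rw [finiteDiffEntropy_iff_integrable] at hUZ hZ
  have h1 : condDiffEntropy P U Z = - ∫ ω, Real.log (condPDF P U Z (U ω) (Z ω)).toReal ∂P := by
    simp only [condPDF, ENNReal.toReal_div]
    rw [condDiffEntropy]
    exact congrArg Neg.neg (pdf.integral_pdf_smul hm)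
  rw [h1, integral_congr_ae (log_condPDF_ae.mono fun ω h => h.2), integral_sub hUZ hZ,
    diffEntropy_eq_integral, diffEntropy_eq_integral]
  ring

variable {ι : Type*} [Fintype ι] {E : ι → Type*} [∀ i, MeasureSpace (E i)]
  [∀ i, SigmaFinite (volume : Measure (E i))] [SigmaFinite (volume : Measure G)]
  {Y : ∀ i, Ω → E i}
  [∀ i, HasPDF (fun ω => (Y i ω, Z ω)) P volume]
  [HasPDF (fun ω => ((fun i => Y i ω), Z ω)) P volume]

/-- Subadditivity of the conditional differential entropy, with its equality case. -/
theorem diffEntropy_le_sum_sub (hY : ∀ i, Measurable (Y i)) (hZ : Measurable Z)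
    (hW : FiniteDiffEntropy P (fun ω => ((fun i => Y i ω), Z ω)))
    (hYZ : ∀ i, FiniteDiffEntropy P (fun ω => (Y i ω, Z ω))) (hZf : FiniteDiffEntropy P Z) :
    diffEntropy P (fun ω => ((fun i => Y i ω), Z ω)) ≤
        ∑ i, (diffEntropy P (fun ω => (Y i ω, Z ω)) - diffEntropy P Z) + diffEntropy P Z ∧
      (diffEntropy P (fun ω => ((fun i => Y i ω), Z ω)) =
        ∑ i, (diffEntropy P (fun ω => (Y i ω, Z ω)) - diffEntropy P Z) + diffEntropy P Z ↔
        CondIndepFamilyGiven P Y Z) := by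
  rw [finiteDiffEntropy_iff_integrable] at hW hZf
  simp_rw [finiteDiffEntropy_iff_integrable] at hYZ
  have hg : ∀ᵐ ω ∂P, 0 < (condProdPDF P Y Z ((fun i => Y i ω), Z ω)).toReal ∧
      Real.log (condProdPDF P Y Z ((fun i => Y i ω), Z ω)).toReal =
      ∑ i, (Real.log (pdf (fun ω => (Y i ω, Z ω)) P volume (Y i ω, Z ω)).toReal -
        Real.log (pdf Z P volume (Z ω)).toReal) + Real.log (pdf Z P volume (Z ω)).toReal := by
    filter_upwards [ae_all_iff.2 fun i => log_condPDF_ae (P := P) (Z := Z) (U := Y i),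
      pdf_comp_toReal_pos_ae (P := P) (W := Z)] with ω h1 h2
    simp only [condProdPDF]
    rw [ENNReal.toReal_mul, ENNReal.toReal_prod]
    refine ⟨mul_pos h2 (Finset.prod_pos fun i _ => (h1 i).1), ?_⟩
    rw [Real.log_mul h2.ne' (Finset.prod_pos fun i _ => (h1 i).1).ne',
      Real.log_prod fun i _ => (h1 i).1.ne', add_comm,
      Finset.sum_congr rfl fun i _ => (h1 i).2]
  have hsub : ∀ i, Integrable (fun ω =>
      Real.log (pdf (fun ω => (Y i ω, Z ω)) P volume (Y i ω, Z ω)).toReal -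
        Real.log (pdf Z P volume (Z ω)).toReal) P := fun i => (hYZ i).sub hZf
  have hsum : Integrable (fun ω => ∑ i,
      (Real.log (pdf (fun ω => (Y i ω, Z ω)) P volume (Y i ω, Z ω)).toReal -
        Real.log (pdf Z P volume (Z ω)).toReal)) P :=
    integrable_finsetSum _ fun i _ => hsub i
  have hgint : Integrable
      (fun ω => Real.log (condProdPDF P Y Z ((fun i => Y i ω), Z ω)).toReal) P :=
    (integrable_congr (hg.mono fun ω h => h.2)).2 (hsum.add hZf)
  have hval : ∫ ω, Real.log (condProdPDF P Y Z ((fun i => Y i ω), Z ω)).toReal ∂P =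
      -(∑ i, (diffEntropy P (fun ω => (Y i ω, Z ω)) - diffEntropy P Z) + diffEntropy P Z) := by
    rw [integral_congr_ae (hg.mono fun ω h => h.2), integral_add hsum hZf,
      integral_finsetSum _ fun i _ => hsub i, neg_add, ← Finset.sum_neg_distrib]
    congr 1
    · refine Finset.sum_congr rfl fun i _ => ?_
      rw [integral_sub (hYZ i) hZf, diffEntropy_eq_integral, diffEntropy_eq_integral]
      ring
    · rw [diffEntropy_eq_integral, neg_neg]
  -- Minus the right-hand side of the claim is $E\log g$, so Gibbs gives both the bound and its
  -- equality case.
  have hgibbs := integral_log_le_integral_log_pdf (W := fun ω => ((fun i => Y i ω), Z ω))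
    (measurable_condProdPDF P Y Z) (lintegral_condProdPDF hY hZ).le
    (hg.mono fun ω h h0 => by simp [h0] at h) hW hgint
  rw [hval, ← condIndepFamilyGiven_iff_map_eq hY hZ] at hgibbs
  rw [diffEntropy_eq_integral (W := fun ω => ((fun i => Y i ω), Z ω))]
  refine ⟨by linarith [hgibbs.1], ?_⟩
  rw [← hgibbs.2]
  constructor <;> intro h <;> linarith

end Entropy

/-! ### Invariance of entropy under volume-preserving equivalences -/

section Transport

variable {Ω E E' : Type*} [MeasurableSpace Ω] [MeasureSpace E] [MeasureSpace E'] {P : Measure Ω}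
  [IsProbabilityMeasure P] [SigmaFinite (volume : Measure E)] {W : Ω → E} {e : E ≃ᵐ E'}

theorem pdf_comp_measurableEquiv (he : MeasurePreserving e) (hW : Measurable W) :
    ∀ᵐ x, pdf (e ∘ W) P volume (e x) = pdf W P volume x := by
  have := Measure.isProbabilityMeasure_map (μ := P) hW.aemeasurable
  have h := e.measurableEmbedding.rnDeriv_map (P.map W) volume
  rw [he.map_eq, Measure.map_map e.measurable hW] at h
  exact h

theorem diffEntropy_comp_measurableEquiv (he : MeasurePreserving e) (hW : Measurable W) :
    diffEntropy P (e ∘ W) = diffEntropy P W := by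
  rw [diffEntropy, ← he.integral_comp e.measurableEmbedding, diffEntropy]
  congr 1
  refine integral_congr_ae ?_
  filter_upwards [pdf_comp_measurableEquiv (P := P) he hW] with x hx
  rw [hx]

theorem finiteDiffEntropy_comp_measurableEquiv (he : MeasurePreserving e) (hW : Measurable W) :
    FiniteDiffEntropy P (e ∘ W) ↔ FiniteDiffEntropy P W := by
  rw [FiniteDiffEntropy, ← he.integrable_comp_emb e.measurableEmbedding, FiniteDiffEntropy]
  refine integrable_congr ?_
  filter_upwards [pdf_comp_measurableEquiv (P := P) he hW] with x hx
  simp only [Function.comp_apply]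
  rw [hx]

end Transport

/-! ### Volume-preserving splittings of coordinate spaces -/

section Split

/-- The preimage of a box is a box of boxes, whose volume is the same iterated product. -/
theorem measurePreserving_piCurry_symm {ι : Type*} [Fintype ι] {κ : ι → Type*}
    [∀ i, Fintype (κ i)] :
    MeasurePreserving (MeasurableEquiv.piCurry fun (i : ι) (_ : κ i) => ℝ).symm := by
  refine ⟨MeasurableEquiv.measurable _, ?_⟩
  rw [volume_pi (ι := Σ i, κ i)]
  refine (Measure.pi_eq fun s hs => ?_).symm
  rw [MeasurableEquiv.map_apply]
  have : (MeasurableEquiv.piCurry fun (i : ι) (_ : κ i) => ℝ).symm ⁻¹' Set.univ.pi s =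
      Set.univ.pi fun i => Set.univ.pi fun j => s ⟨i, j⟩ := by
    ext x
    simp only [Set.mem_preimage, Set.mem_pi, Set.mem_univ, forall_const, Sigma.forall]
    rfl
  rw [this, volume_pi_pi, Fintype.prod_sigma]
  exact Finset.prod_congr rfl fun i _ => volume_pi_pi _

variable {ι α β κ : Type*} {γ : ι → Type*} [Fintype κ]

/-- Splitting `κ → ℝ` along `ε : α ⊕ β ≃ κ`. -/
def splitPair (ε : α ⊕ β ≃ κ) : (κ → ℝ) ≃ᵐ (α → ℝ) × (β → ℝ) :=
  (MeasurableEquiv.piCongrLeft (fun _ : κ => ℝ) ε).symm.trans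
    (MeasurableEquiv.sumPiEquivProdPi fun _ : α ⊕ β => ℝ)

theorem measurePreserving_splitPair [Fintype α] [Fintype β] (ε : α ⊕ β ≃ κ) :
    MeasurePreserving (splitPair ε) :=
  (volume_measurePreserving_sumPiEquivProdPi fun _ : α ⊕ β => ℝ).comp
    ((volume_measurePreserving_piCongrLeft (fun _ : κ => ℝ) ε).symm)

/-- Splitting `κ → ℝ` along `ε : (Σ i, γ i) ⊕ β ≃ κ`. -/
def splitFamily (ε : (Σ i, γ i) ⊕ β ≃ κ) : (κ → ℝ) ≃ᵐ (∀ i, γ i → ℝ) × (β → ℝ) :=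
  (splitPair ε).trans
    ((MeasurableEquiv.piCurry fun (i : ι) (_ : γ i) => ℝ).prodCongr (MeasurableEquiv.refl _))

theorem measurePreserving_splitFamily [Fintype ι] [∀ i, Fintype (γ i)] [Fintype β]
    (ε : (Σ i, γ i) ⊕ β ≃ κ) : MeasurePreserving (splitFamily ε) :=
  ((measurePreserving_piCurry_symm.symm _).prod (MeasurePreserving.id volume)).comp
    (measurePreserving_splitPair ε)

end Split

/-! ### The inequality for subvectors -/

section Subvector

variable {n : ℕ} {Ω : Type*} {X : Fin n → Ω → ℝ}

theorem measurable_subvector [MeasurableSpace Ω] (hX : ∀ i, Measurable (X i)) (S : Finset (Fin n)) :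
    Measurable (subvector X S) :=
  measurable_pi_lambda _ fun i => hX i

theorem exists_splitPair_subvector {S T : Finset (Fin n)} (hST : Disjoint S T) :
    ∃ e : (↥(S ∪ T) → ℝ) ≃ᵐ (S → ℝ) × (T → ℝ), MeasurePreserving e ∧
      e ∘ subvector X (S ∪ T) = fun ω => (subvector X S ω, subvector X T ω) := by
  let f : S ⊕ T → ↥(S ∪ T) :=
    Sum.elim (fun s => ⟨s, Finset.mem_union_left _ s.2⟩) fun t => ⟨t, Finset.mem_union_right _ t.2⟩
  have hf : Function.Bijective f := by
    constructor
    · rintro (⟨a, ha⟩ | ⟨a, ha⟩) (⟨b, hb⟩ | ⟨b, hb⟩) h <;>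
        simp only [f, Sum.elim_inl, Sum.elim_inr, Subtype.mk.injEq] at h <;> subst h
      · rfl
      · exact (Finset.disjoint_left.1 hST ha hb).elim
      · exact (Finset.disjoint_left.1 hST hb ha).elim
      · rfl
    · rintro ⟨a, ha⟩
      rcases Finset.mem_union.1 ha with h | h
      exacts [⟨.inl ⟨a, h⟩, rfl⟩, ⟨.inr ⟨a, h⟩, rfl⟩]
  exact ⟨splitPair (Equiv.ofBijective f hf), measurePreserving_splitPair _, rfl⟩

theorem exists_splitFamily_subvector {ι : Type*} [Fintype ι] {S : ι → Finset (Fin n)}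
    {T : Finset (Fin n)} (hS : Pairwise fun i j => Disjoint (S i) (S j))
    (hST : ∀ i, Disjoint (S i) T) :
    ∃ e : (↥(Finset.univ.biUnion S ∪ T) → ℝ) ≃ᵐ (∀ i, S i → ℝ) × (T → ℝ), MeasurePreserving e ∧
      e ∘ subvector X (Finset.univ.biUnion S ∪ T) =
        fun ω => (fun i => subvector X (S i) ω, subvector X T ω) := by
  let f : (Σ i, S i) ⊕ T → ↥(Finset.univ.biUnion S ∪ T) :=
    Sum.elim (fun s => ⟨s.2, Finset.mem_union_left _
      (Finset.mem_biUnion.2 ⟨s.1, Finset.mem_univ _, s.2.2⟩)⟩)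
      fun t => ⟨t, Finset.mem_union_right _ t.2⟩
  have hf : Function.Bijective f := by
    constructor
    · rintro (⟨i, a, ha⟩ | ⟨a, ha⟩) (⟨j, b, hb⟩ | ⟨b, hb⟩) h <;>
        simp only [f, Sum.elim_inl, Sum.elim_inr, Subtype.mk.injEq] at h <;> subst h
      · by_cases hij : i = j
        · subst hij
          rfl
        · exact (Finset.disjoint_left.1 (hS hij) ha hb).elim
      · exact (Finset.disjoint_left.1 (hST i) ha hb).elim
      · exact (Finset.disjoint_left.1 (hST j) hb ha).elim
      · rfl
    · rintro ⟨a, ha⟩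
      rcases Finset.mem_union.1 ha with h | h
      · obtain ⟨i, -, hi⟩ := Finset.mem_biUnion.1 h
        exact ⟨.inl ⟨i, a, hi⟩, rfl⟩
      · exact ⟨.inr ⟨a, h⟩, rfl⟩
  exact ⟨splitFamily (Equiv.ofBijective f hf), measurePreserving_splitFamily _, rfl⟩

variable [MeasurableSpace Ω] {P : Measure Ω} [IsProbabilityMeasure P]

/-- `ℝ ^ ∅` is a point of volume one, so the density is 1 and its logarithm 0. -/
theorem diffEntropy_subvector_empty : diffEntropy P (subvector X ∅) = 0 := by
  have hm : Measurable (subvector X ∅) := measurable_of_subsingleton_codomain _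
  have hvol : P.map (subvector X ∅) = (volume : Measure ((∅ : Finset (Fin n)) → ℝ)) := by
    ext s hs
    rcases Set.eq_empty_or_nonempty s with rfl | h
    · simp
    · rw [Subsingleton.eq_univ_of_nonempty h, Measure.map_apply hm .univ, Set.preimage_univ,
        measure_univ, volume_pi, Measure.pi_univ]
      rfl
  rw [diffEntropy, neg_eq_zero]
  refine integral_eq_zero_of_ae ?_
  have h1 : pdf (subvector X ∅) P volume =ᵐ[volume] fun _ => 1 := by
    rw [pdf_def, hvol]
    exact Measure.rnDeriv_self _
  filter_upwards [h1] with x hx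
  simp [hx]

/-- `X_S` is a projection of the split full vector, and projections carry null sets back to null
sets. -/
theorem hasPDF_subvector
    (hcont : HasPDF (fun ω i => X i ω) P (volume : Measure (Fin n → ℝ))) (S : Finset (Fin n)) :
    HasPDF (subvector X S) P volume := by
  have h := (measurePreserving_splitPair
    (Equiv.sumCompl fun i : Fin n => i ∈ S)).quasiMeasurePreserving
  exact pdf.quasiMeasurePreserving_hasPDF' (fun ω i => X i ω)
    (Measure.quasiMeasurePreserving_fst.comp h)

theorem condDiffEntropy_subvector (hX : ∀ i, Measurable (X i))
    (hcont : HasPDF (fun ω i => X i ω) P (volume : Measure (Fin n → ℝ)))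
    (hfin : ∀ S : Finset (Fin n), FiniteDiffEntropy P (subvector X S)) {S T : Finset (Fin n)}
    (hST : Disjoint S T) :
    condDiffEntropy P (subvector X S) (subvector X T) =
      diffEntropy P (subvector X (S ∪ T)) - diffEntropy P (subvector X T) := by
  obtain ⟨e, he, hcomp⟩ := exists_splitPair_subvector (X := X) hST
  have hm := measurable_subvector hX (S ∪ T)
  have := hasPDF_subvector hcont T
  have := hasPDF_subvector hcont (S ∪ T)
  have : HasPDF (fun ω => (subvector X S ω, subvector X T ω)) P volume := by
    rw [← hcomp]
    exact pdf.quasiMeasurePreserving_hasPDF' _ he.quasiMeasurePreserving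
  rw [condDiffEntropy_eq_sub _ (hfin T), ← hcomp, diffEntropy_comp_measurableEquiv he hm]
  rw [← hcomp, finiteDiffEntropy_comp_measurableEquiv he hm]
  exact hfin _

/-- The union is a free variable `U` with an equation, since the type of `subvector X U` depends on
`U`. -/
theorem diffEntropy_subvector_le (hX : ∀ i, Measurable (X i))
    (hcont : HasPDF (fun ω i => X i ω) P (volume : Measure (Fin n → ℝ)))
    (hfin : ∀ S : Finset (Fin n), FiniteDiffEntropy P (subvector X S))
    {ι : Type*} [Fintype ι] {S : ι → Finset (Fin n)}
    {T U : Finset (Fin n)} (hS : Pairwise fun i j => Disjoint (S i) (S j))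
    (hST : ∀ i, Disjoint (S i) T) (hU : Finset.univ.biUnion S ∪ T = U) :
    diffEntropy P (subvector X U) ≤
        ∑ i, (diffEntropy P (subvector X (S i ∪ T)) - diffEntropy P (subvector X T)) +
          diffEntropy P (subvector X T) ∧
      (diffEntropy P (subvector X U) =
        ∑ i, (diffEntropy P (subvector X (S i ∪ T)) - diffEntropy P (subvector X T)) +
          diffEntropy P (subvector X T) ↔
        CondIndepFamilyGiven P (fun i => subvector X (S i)) (subvector X T)) := by
  subst hU
  obtain ⟨e, he, hcomp⟩ := exists_splitFamily_subvector (X := X) hS hST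
  have hm := measurable_subvector hX
  have := hasPDF_subvector hcont T
  have hpair : ∀ i, HasPDF (fun ω => (subvector X (S i) ω, subvector X T ω)) P volume ∧
      FiniteDiffEntropy P (fun ω => (subvector X (S i) ω, subvector X T ω)) ∧
      diffEntropy P (fun ω => (subvector X (S i) ω, subvector X T ω)) =
        diffEntropy P (subvector X (S i ∪ T)) := by
    intro i
    obtain ⟨e, he, hcomp⟩ := exists_splitPair_subvector (X := X) (hST i)
    have := hasPDF_subvector hcont (S i ∪ T)
    rw [← hcomp]
    exact ⟨pdf.quasiMeasurePreserving_hasPDF' _ he.quasiMeasurePreserving,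
      (finiteDiffEntropy_comp_measurableEquiv he (hm _)).2 (hfin _),
      diffEntropy_comp_measurableEquiv he (hm _)⟩
  have := fun i => (hpair i).1
  have := hasPDF_subvector hcont (Finset.univ.biUnion S ∪ T)
  have : HasPDF (fun ω => (fun i => subvector X (S i) ω, subvector X T ω)) P volume := by
    rw [← hcomp]
    exact pdf.quasiMeasurePreserving_hasPDF' _ he.quasiMeasurePreserving
  have hfinW : FiniteDiffEntropy P
      (fun ω => (fun i => subvector X (S i) ω, subvector X T ω)) := by
    rw [← hcomp]
    exact (finiteDiffEntropy_comp_measurableEquiv he (hm _)).2 (hfin _)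
  have h := diffEntropy_le_sum_sub (P := P) (Y := fun i => subvector X (S i))
    (fun i => hm (S i)) (hm T) hfinW (fun i => (hpair i).2.1) (hfin T)
  simp only [(hpair _).2.2] at h
  rwa [← hcomp, diffEntropy_comp_measurableEquiv he (hm _)] at h

end Subvector

/-! ### Combinatorics of the partition -/

section Blocks

variable {n : ℕ} (p : ℕ)

theorem disjoint_initialIdx_finalIdx : Disjoint (initialIdx n p) (finalIdx n p) := by
  rw [Finset.disjoint_left]
  intro i hi hj
  simp only [initialIdx, finalIdx, Finset.mem_filter, Finset.mem_univ, true_and] at hi hj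
  omega

theorem initialIdx_union_finalIdx : initialIdx n p ∪ finalIdx n p = Finset.univ := by
  ext i
  simp only [initialIdx, finalIdx, Finset.mem_union, Finset.mem_filter, Finset.mem_univ, true_and,
    iff_true]
  omega

variable (𝓟 : Finpartition (Finset.univ : Finset (Fin n)))

/-- Parts meeting the initial indices have distinct traces, being disjoint; the other parts
contribute `φ ∅ = 0`. -/
theorem sum_inducedBlocks {φ : Finset (Fin n) → ℝ} (hφ : φ ∅ = 0) :
    ∑ S ∈ inducedBlocks 𝓟 p, φ S = ∑ S ∈ 𝓟.parts, φ (S ∩ initialIdx n p) := by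
  rw [inducedBlocks, Finset.sum_image, Finset.sum_filter_of_ne]
  · intro S _ hne
    by_contra h
    rw [Finset.not_nonempty_iff_eq_empty] at h
    exact hne (h ▸ hφ)
  · intro S hS S' hS' h
    simp only [Finset.coe_filter, Set.mem_ofPred_eq] at hS hS'
    obtain ⟨x, hx⟩ := hS.2
    have hx' : x ∈ S' ∩ initialIdx n p := by
      simp only at h
      rwa [← h]
    exact 𝓟.eq_of_mem_parts hS.1 hS'.1 (Finset.mem_of_mem_inter_left hx)
      (Finset.mem_of_mem_inter_left hx')

theorem pairwise_disjoint_inducedBlocks :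
    Pairwise fun S T : {S // S ∈ inducedBlocks 𝓟 p} => Disjoint S.1 T.1 := by
  rintro ⟨_, hS⟩ ⟨_, hT⟩ hne
  have hS' := hS
  have hT' := hT
  simp only [inducedBlocks, Finset.mem_image, Finset.mem_filter] at hS' hT'
  obtain ⟨S, ⟨hSP, -⟩, rfl⟩ := hS'
  obtain ⟨T, ⟨hTP, -⟩, rfl⟩ := hT'
  have hST : S ≠ T := fun h => hne (Subtype.ext (by simp only [h]))
  exact (𝓟.disjoint hSP hTP hST).mono Finset.inter_subset_left Finset.inter_subset_left

theorem subset_initialIdx_of_mem_inducedBlocks {S : Finset (Fin n)}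
    (hS : S ∈ inducedBlocks 𝓟 p) : S ⊆ initialIdx n p := by
  simp only [inducedBlocks, Finset.mem_image] at hS
  obtain ⟨S, -, rfl⟩ := hS
  exact Finset.inter_subset_right

theorem biUnion_inducedBlocks_union_finalIdx :
    (Finset.univ.biUnion fun S : {S // S ∈ inducedBlocks 𝓟 p} => S.1) ∪ finalIdx n p =
      Finset.univ := by
  rw [Finset.eq_univ_iff_forall]
  intro x
  have hx : x ∈ initialIdx n p ∪ finalIdx n p := by
    rw [initialIdx_union_finalIdx]
    exact Finset.mem_univ x
  rcases Finset.mem_union.1 hx with h | h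
  · obtain ⟨S, hS, hxS⟩ := 𝓟.exists_mem (Finset.mem_univ x)
    have hxI : x ∈ S ∩ initialIdx n p := Finset.mem_inter.2 ⟨hxS, h⟩
    exact Finset.mem_union_left _ (Finset.mem_biUnion.2 ⟨⟨S ∩ initialIdx n p,
      Finset.mem_image.2 ⟨S, Finset.mem_filter.2 ⟨hS, x, hxI⟩, rfl⟩⟩, Finset.mem_univ _, hxI⟩)
  · exact Finset.mem_union_right _ h

theorem pairwise_disjoint_parts_inter (F : Finset (Fin n)) :
    Pairwise fun S T : {S // S ∈ 𝓟.parts} => Disjoint (S.1 ∩ F) (T.1 ∩ F) := fun S T hne =>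
  (𝓟.disjoint S.2 T.2 (Subtype.coe_ne_coe.2 hne)).mono Finset.inter_subset_left
    Finset.inter_subset_left

theorem biUnion_parts_inter (F : Finset (Fin n)) :
    (Finset.univ.biUnion fun S : {S // S ∈ 𝓟.parts} => S.1 ∩ F) ∪ ∅ = F := by
  ext x
  simp only [Finset.union_empty, Finset.mem_biUnion, Finset.mem_univ, true_and, Finset.mem_inter]
  refine ⟨fun ⟨_, _, h⟩ => h, fun h => ?_⟩
  obtain ⟨S, hS, hxS⟩ := 𝓟.exists_mem (Finset.mem_univ x)
  exact ⟨⟨S, hS⟩, hxS, h⟩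

end Blocks

/-! ### Conditioning reduces entropy -/

section Conditioning

variable {n : ℕ} {Ω : Type*} [MeasurableSpace Ω] {X : Fin n → Ω → ℝ} {P : Measure Ω}
  [IsProbabilityMeasure P]

/-- Conditioning reduces differential entropy, with its equality case. -/
theorem diffEntropy_subvector_union_sub_le (hX : ∀ i, Measurable (X i))
    (hcont : HasPDF (fun ω i => X i ω) P (volume : Measure (Fin n → ℝ)))
    (hfin : ∀ S : Finset (Fin n), FiniteDiffEntropy P (subvector X S))
    {A B C : Finset (Fin n)} (hAB : Disjoint A B) (hAC : Disjoint A C) (hBC : Disjoint B C) :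
    diffEntropy P (subvector X (A ∪ (B ∪ C))) - diffEntropy P (subvector X (B ∪ C)) ≤
        diffEntropy P (subvector X (A ∪ C)) - diffEntropy P (subvector X C) ∧
      (diffEntropy P (subvector X (A ∪ (B ∪ C))) - diffEntropy P (subvector X (B ∪ C)) =
        diffEntropy P (subvector X (A ∪ C)) - diffEntropy P (subvector X C) ↔
        CondIndepPairGiven P (subvector X A) (subvector X B) (subvector X C)) := by
  -- Two-block case given `C`; moving $h(X_{B\cup C})$ to the left gives the claim.
  let S : Bool → Finset (Fin n) := fun b => if b then A else B
  have hS : Pairwise fun i j => Disjoint (S i) (S j) := by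
    rintro (_ | _) (_ | _) h
    exacts [(h rfl).elim, hAB.symm, hAB, (h rfl).elim]
  have hSC : ∀ i, Disjoint (S i) C := by
    rintro (_ | _)
    exacts [hBC, hAC]
  have hU : Finset.univ.biUnion S ∪ C = A ∪ (B ∪ C) := by
    ext x
    simp [S]
  have h := diffEntropy_subvector_le hX hcont hfin hS hSC hU
  rw [← condIndepPairGiven_iff_family (Y := fun b => subvector X (S b))
    (measurable_subvector hX C), Fintype.sum_bool] at h
  change _ ≤ (diffEntropy P (subvector X (A ∪ C)) - _) +
    (diffEntropy P (subvector X (B ∪ C)) - _) + _ ∧ (_ =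
    (diffEntropy P (subvector X (A ∪ C)) - _) +
    (diffEntropy P (subvector X (B ∪ C)) - _) + _ ↔
    CondIndepPairGiven P (subvector X A) (subvector X B) (subvector X C)) at h
  refine ⟨by linarith [h.1], ?_⟩
  rw [← h.2]
  constructor <;> intro h <;> linarith

end Conditioning

/-! ### The two inequalities and their equality cases -/

theorem proposition2 {Ω : Type*} [MeasurableSpace Ω] (P : Measure Ω) [IsProbabilityMeasure P]
    (n : ℕ) (X : Fin n → Ω → ℝ) (hX : ∀ i, Measurable (X i))
    (hcont : HasPDF (fun ω i => X i ω) P (volume : Measure (Fin n → ℝ)))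
    (hfin : ∀ S : Finset (Fin n), FiniteDiffEntropy P (subvector X S))
    (p : ℕ) (hp : 1 ≤ p) (hpn : p ≤ n)
    (𝓟 : Finpartition (Finset.univ : Finset (Fin n))) :
    diffEntropy P (subvector X Finset.univ) ≤
        (∑ S ∈ inducedBlocks 𝓟 p,
          condDiffEntropy P (subvector X S) (subvector X (finalIdx n p))) +
          diffEntropy P (subvector X (finalIdx n p)) ∧
    (∑ S ∈ inducedBlocks 𝓟 p,
          condDiffEntropy P (subvector X S) (subvector X (finalIdx n p))) +
          diffEntropy P (subvector X (finalIdx n p)) ≤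
        ∑ S ∈ 𝓟.parts, diffEntropy P (subvector X S) ∧
    (diffEntropy P (subvector X Finset.univ) =
        (∑ S ∈ inducedBlocks 𝓟 p,
          condDiffEntropy P (subvector X S) (subvector X (finalIdx n p))) +
          diffEntropy P (subvector X (finalIdx n p)) ↔
      CondIndepFamilyGiven P
        (fun S : {S : Finset (Fin n) // S ∈ inducedBlocks 𝓟 p} => subvector X S.1)
        (subvector X (finalIdx n p))) ∧
    ((∑ S ∈ inducedBlocks 𝓟 p,
          condDiffEntropy P (subvector X S) (subvector X (finalIdx n p))) +
          diffEntropy P (subvector X (finalIdx n p)) =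
        ∑ S ∈ 𝓟.parts, diffEntropy P (subvector X S) ↔
      (∀ S ∈ 𝓟.parts,
        CondIndepPairGiven P (subvector X (S ∩ initialIdx n p))
          (subvector X (Sᶜ ∩ finalIdx n p)) (subvector X (S ∩ finalIdx n p))) ∧
      iIndepFun
        (fun S : {S : Finset (Fin n) // S ∈ 𝓟.parts} => subvector X (S.1 ∩ finalIdx n p)) P) := by
  set I := initialIdx n p with hI
  set F := finalIdx n p with hF
  have hIF : Disjoint I F := disjoint_initialIdx_finalIdx p
  have hdisj : ∀ S ∈ inducedBlocks 𝓟 p, Disjoint S F := fun S hS =>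
    hIF.mono_left (subset_initialIdx_of_mem_inducedBlocks p 𝓟 hS)
  have hcond : ∑ S ∈ inducedBlocks 𝓟 p, condDiffEntropy P (subvector X S) (subvector X F) =
      ∑ S ∈ inducedBlocks 𝓟 p,
        (diffEntropy P (subvector X (S ∪ F)) - diffEntropy P (subvector X F)) :=
    Finset.sum_congr rfl fun S hS => condDiffEntropy_subvector hX hcont hfin (hdisj S hS)
  rw [hcond]
  have hfirst := diffEntropy_subvector_le (P := P) hX hcont hfin
    (pairwise_disjoint_inducedBlocks p 𝓟) (fun S => hdisj S.1 S.2)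
    (biUnion_inducedBlocks_union_finalIdx p 𝓟)
  rw [Finset.sum_coe_sort (inducedBlocks 𝓟 p) fun S =>
    diffEntropy P (subvector X (S ∪ F)) - diffEntropy P (subvector X F)] at hfirst
  have hindep := diffEntropy_subvector_le (P := P) hX hcont hfin
    (pairwise_disjoint_parts_inter 𝓟 F) (fun S => Finset.disjoint_empty_right _)
    (biUnion_parts_inter 𝓟 F)
  have hunion : ∀ S : Finset (Fin n),
      diffEntropy P (subvector X (S ∪ ∅)) = diffEntropy P (subvector X S) := fun S => by
    rw [Finset.union_empty]
  simp only [hunion, diffEntropy_subvector_empty, sub_zero, add_zero] at hindep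
  rw [condIndepFamilyGiven_iff_iIndepFun fun S => measurable_subvector hX _,
    Finset.sum_coe_sort 𝓟.parts fun S => diffEntropy P (subvector X (S ∩ F))] at hindep
  have hblock : ∀ S : Finset (Fin n),
      diffEntropy P (subvector X (S ∩ I ∪ F)) - diffEntropy P (subvector X F) ≤
        diffEntropy P (subvector X S) - diffEntropy P (subvector X (S ∩ F)) ∧
      (diffEntropy P (subvector X (S ∩ I ∪ F)) - diffEntropy P (subvector X F) =
        diffEntropy P (subvector X S) - diffEntropy P (subvector X (S ∩ F)) ↔
        CondIndepPairGiven P (subvector X (S ∩ I)) (subvector X (Sᶜ ∩ F))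
          (subvector X (S ∩ F))) := by
    intro S
    have h := diffEntropy_subvector_union_sub_le (P := P) hX hcont hfin
      (A := S ∩ I) (B := Sᶜ ∩ F) (C := S ∩ F)
      (hIF.mono Finset.inter_subset_right Finset.inter_subset_right)
      (hIF.mono Finset.inter_subset_right Finset.inter_subset_right)
      (disjoint_compl_left.mono Finset.inter_subset_left Finset.inter_subset_left)
    -- Here $B\cup C=F$ and $A\cup C=S$.
    rwa [← Finset.union_inter_distrib_right, Finset.union_comm Sᶜ S, Finset.union_compl,
      Finset.univ_inter, ← Finset.inter_union_distrib_left, hI, hF, initialIdx_union_finalIdx,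
      Finset.inter_univ] at h
  have hsum := sum_inducedBlocks p 𝓟 (φ := fun S =>
    diffEntropy P (subvector X (S ∪ F)) - diffEntropy P (subvector X F))
    (by rw [Finset.empty_union, sub_self])
  have hle := Finset.sum_le_sum fun S (_ : S ∈ 𝓟.parts) => (hblock S).1
  -- Equality of the sums is equality for every part, which is condition (i).
  have heq := Finset.sum_eq_sum_iff_of_le fun S (_ : S ∈ 𝓟.parts) => (hblock S).1
  rw [← hsum, Finset.sum_sub_distrib (s := 𝓟.parts)] at hle heq
  refine ⟨hfirst.1, by linarith [hindep.1], hfirst.2, ?_⟩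
  rw [← hindep.2, ← forall₂_congr fun S _ => (hblock S).2, ← heq]
  -- The second claim is the sum of `hle` and `hindep.1`, so it is an equality iff both are.
  constructor
  · intro h
    constructor <;> linarith [hindep.1]
  · rintro ⟨h1, h2⟩
    linarith
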